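/- Let $p\ge 2$ be an integer and let $k,m\ge 0$ be integers with $k\ge m-1$ and $k+m\ge 1$. Write $(a)_n=a(a+1)\cdots(a+n-1)$, $(a)_0=1$, and $$\alpha=\frac{p\,k!\,m!\,(\frac1p)_{k+1}(1-\frac1p)_m}{(k+m)!\,(k+m+1)!}.$$ Then $\alpha<1$. The function $(1-z)^{-1/p}$ (principal branch) has a Padé approximant $P_{km}/Q_{km}$ of type $[k/m]$ at $0$, that is, there are coprime complex polynomials $P_{km},Q_{km}$ with $\deg P_{km}\le k$, $\deg Q_{km}\le m$, $Q_{km}(0)=1$ and $(1-z)^{-1/p}-P_{km}(z)/Q_{km}(z)=O(z^{k+m+1})$ as $z\to0$; and for such polynomials the following holds. The number $\alpha$ is the first nonzero Taylor coefficient at $0$, namely that of $t^{k+m+1}$, of $f_{km}(t)=1-(1-t)\left(P_{km}(t)/Q_{km}(t)\right)^p$. If $x_0\in\mathbb C$ satisfies $|1-x_0^p|<1$, then the sequence $$x_{l+1}=x_l\,\frac{P_{km}(1-x_l^p)}{Q_{km}(1-x_l^p)},\qquad l=0,1,2,\dots,$$ is well defined (no denominator vanishes) and, for all $l\ge0$,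 $$|1-x_l^p|\le|1-x_0^p|^{(k+m+1)^l}\left(\frac{|1-x_0^p|+\alpha}{1+\alpha|1-x_0^p|}\right)^{((k+m+1)^l-1)/(k+m)}.$$ -/

import Mathlib

open Filter Topology Polynomial

noncomputable section

/-- `P / Q` is the `[k/m]` Padé approximant of `f` at `0`, written in lowest terms and with the
normalization `Q(0) = 1`. -/
structure IsPadeApproximant (f : ℂ → ℂ) (k m : ℕ) (P Q : ℂ[X]) : Prop where
  natDegree_num_le : P.natDegree ≤ k
  natDegree_den_le : Q.natDegree ≤ m
  den_zero : Q.eval 0 = 1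
  coprime : IsCoprime P Q
  isBigO : (fun z : ℂ => f z - P.eval z / Q.eval z) =O[𝓝 0] fun z : ℂ => z ^ (k + m + 1)

/-- The function `z ↦ (1 - z)^(-1/p)` (principal branch). -/
def invRoot (p : ℕ) (z : ℂ) : ℂ := (1 - z) ^ (-(1 / (p : ℂ)))

/-- The iteration function `h(x) = x P(1 - x^p) / Q(1 - x^p)`. -/
def padeStep (p : ℕ) (P Q : ℂ[X]) (x : ℂ) : ℂ :=
  x * (P.eval (1 - x ^ p) / Q.eval (1 - x ^ p))

/-- The region `{z : |1 - z^p| < 1}`. -/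
def padeRegion (p : ℕ) : Set ℂ := {z | ‖1 - z ^ p‖ < 1}

/-- The residual function `f(t) = 1 - (1 - t) (P(t) / Q(t))^p`. -/
def padeResidual (p : ℕ) (P Q : ℂ[X]) (t : ℂ) : ℂ :=
  1 - (1 - t) * (P.eval t / Q.eval t) ^ p

/-- `α = p k! m! (1/p)_{k+1} (1 - 1/p)_m / ((k+m)! (k+m+1)!)`, where `(a)_n` is the rising
factorial. -/
def padeAlpha (p k m : ℕ) : ℝ :=
  (p : ℝ) * (k.factorial : ℝ) * (m.factorial : ℝ) *
      (ascPochhammer ℝ (k + 1)).eval (1 / (p : ℝ)) *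
      (ascPochhammer ℝ m).eval (1 - 1 / (p : ℝ)) /
    (((k + m).factorial : ℝ) * ((k + m + 1).factorial : ℝ))

end

/-! Write F = (1-X)^(-1/p), R = P/Q for its Padé approximant, f = 1 - (1-X) R^p and N = k+m+1. One
step of the iteration sends t = 1 - x^p to f(t), so it is enough that f starts with α X^N and has
nonnegative coefficients of total sum at most 1. Then, with r = |t|, |f(t)| ≤ α r^N + (1-α) r^(N+1)
≤ r^N (r+α)/(1+αr), and the last factor is monotone in r, so the bound iterates.

Nonnegativity has two sources. Removing the first k+1-m Taylor terms of F leaves a power of X times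
a ₂F₁ whose Gauss continued fraction has nonnegative coefficients. Its truncation yields P and Q,
with 1/Q and R nonnegative (`exists_convergent`, `exists_formal_pade`); `prod_gaussCoeff` computes
the leading error. Moreover PQ - p(1-X)(P'Q - PQ') has degree at most k+m and, because F = p(1-X)F',
vanishes to order k+m at 0, so it is a monomial (`pade_wronskian`), with positive coefficient. Since
f' is this monomial times R^(p-1)/Q^2, f is nonnegative.

The partial sums of f telescope to 1 - [X^n] R^p ≤ 1. They are also nonnegative, so the coefficients
of R^p, hence those of R, are at most 1. Thus R converges on the unit disc, and Q, coprime to P, has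
no zero there. -/

open scoped PowerSeries

/-- A real power series all of whose coefficients are nonnegative. -/
def NonnegCoeff (A : ℝ⟦X⟧) : Prop := ∀ n, 0 ≤ PowerSeries.coeff n A

/-! ### Power series with nonnegative coefficients -/

namespace NonnegCoeff

theorem one : NonnegCoeff 1 := fun n => by
  rw [PowerSeries.coeff_one]; split_ifs <;> norm_num

theorem zero : NonnegCoeff 0 := fun n => by simp

theorem X : NonnegCoeff PowerSeries.X := fun n => by
  rw [PowerSeries.coeff_X]; split_ifs <;> norm_num

theorem C {a : ℝ} (ha : 0 ≤ a) : NonnegCoeff (PowerSeries.C a) := fun n => by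
  rw [PowerSeries.coeff_C]; split_ifs <;> simp [ha]

theorem add {A B : ℝ⟦X⟧} (hA : NonnegCoeff A) (hB : NonnegCoeff B) : NonnegCoeff (A + B) :=
  fun n => by rw [map_add]; exact add_nonneg (hA n) (hB n)

theorem mul {A B : ℝ⟦X⟧} (hA : NonnegCoeff A) (hB : NonnegCoeff B) : NonnegCoeff (A * B) :=
  fun n => by
    rw [PowerSeries.coeff_mul]
    exact Finset.sum_nonneg fun i _ => mul_nonneg (hA _) (hB _)

theorem pow {A : ℝ⟦X⟧} (hA : NonnegCoeff A) (n : ℕ) : NonnegCoeff (A ^ n) := by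
  induction n with
  | zero => simpa using one
  | succ n ih => rw [pow_succ]; exact ih.mul hA

/-- The inverse satisfies J = 1 + S J; as S has no constant term, each coefficient of J is a
nonnegative combination of earlier ones. -/
theorem exists_inv_one_sub {S : ℝ⟦X⟧} (hS : NonnegCoeff S)
    (h0 : PowerSeries.constantCoeff S = 0) : ∃ J, NonnegCoeff J ∧ J * (1 - S) = 1 := by
  have hJ : (1 - S)⁻¹ * (1 - S) = 1 := PowerSeries.inv_mul_cancel _ (by simp [h0])
  refine ⟨(1 - S)⁻¹, ?_, hJ⟩
  set J := (1 - S)⁻¹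
  have hrec : J = 1 + S * J := by linear_combination hJ
  intro n
  induction n using Nat.strong_induction_on with
  | _ n ih =>
    rw [hrec, map_add, PowerSeries.coeff_mul]
    refine add_nonneg (one n) (Finset.sum_nonneg fun x hx => ?_)
    rcases Nat.eq_zero_or_pos x.1 with h | h
    · rw [h, PowerSeries.coeff_zero_eq_constantCoeff_apply, h0, zero_mul]
    · have := Finset.HasAntidiagonal.mem_antidiagonal.1 hx
      exact mul_nonneg (hS _) (ih _ (by omega))

end NonnegCoeff

/-! ### Truncated continued fractions -/

/-- Convergents of a Stieltjes-type continued fraction: if `F (j+1) = F j + a j X F (j+2)` with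
`a j ≥ 0`, truncating the recurrence after `L` steps gives polynomials `A / B ≈ F 1 / F 0`. -/
theorem exists_convergent (L : ℕ) : ∀ (F : ℕ → ℝ⟦X⟧) (a : ℕ → ℝ), (∀ j, 0 ≤ a j) →
    (∀ j, F (j + 1) = F j + PowerSeries.C (a j) * PowerSeries.X * F (j + 2)) →
    ∃ (A B : ℝ[X]) (I : ℝ⟦X⟧), 2 * B.natDegree ≤ L ∧ (A = 0 ∨ 2 * A.natDegree + 1 ≤ L) ∧
      B.coeff 0 = 1 ∧ NonnegCoeff I ∧ I * (B : ℝ⟦X⟧) = 1 ∧ NonnegCoeff (I * (A : ℝ⟦X⟧)) ∧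
      F 1 * (B : ℝ⟦X⟧) - F 0 * (A : ℝ⟦X⟧) =
        PowerSeries.C (∏ j ∈ Finset.range L, a j) * PowerSeries.X ^ L * F (L + 1) := by
  induction L with
  | zero =>
    intro F a _ _
    exact ⟨0, 1, 1, by simp, by simp, by simp, .one, by simp, by simpa using .zero, by simp⟩
  | succ L ih =>
    intro F a ha hF
    obtain ⟨A, B, I, hB, hA, hB0, hI, hIB, hIA, hF'⟩ :=
      ih (fun j => F (j + 1)) (fun j => a (j + 1)) (fun j => ha _) (fun j => hF _)
    have hS : NonnegCoeff (PowerSeries.C (a 0) * PowerSeries.X * (I * (A : ℝ⟦X⟧))) :=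
      ((NonnegCoeff.C (ha 0)).mul .X).mul hIA
    obtain ⟨J, hJ, hJS⟩ := hS.exists_inv_one_sub (by simp)
    have hcoe : ((B - C (a 0) * X * A : ℝ[X]) : ℝ⟦X⟧) =
        (B : ℝ⟦X⟧) - PowerSeries.C (a 0) * PowerSeries.X * (A : ℝ⟦X⟧) := by simp
    have hfac : (B : ℝ⟦X⟧) - PowerSeries.C (a 0) * PowerSeries.X * (A : ℝ⟦X⟧) =
        (B : ℝ⟦X⟧) * (1 - PowerSeries.C (a 0) * PowerSeries.X * (I * (A : ℝ⟦X⟧))) := by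
      linear_combination (PowerSeries.C (a 0) * PowerSeries.X * (A : ℝ⟦X⟧)) * hIB
    -- If F 2 / F 1 ≈ A / B, then F 1 / F 0 = 1 / (1 - a₀ X F 2 / F 1) ≈ B / (B - a₀ X A). The new
    -- denominator is B (1 - a₀ X A/B), with inverse I * J.
    refine ⟨B, B - C (a 0) * X * A, I * J, ?_, Or.inr (by omega), ?_, hI.mul hJ, ?_, ?_, ?_⟩
    · have h1 : (C (a 0) * X * A).natDegree ≤ 1 + A.natDegree := by
        rw [mul_assoc]
        refine (natDegree_C_mul_le _ _).trans (natDegree_mul_le.trans ?_)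
        simp
      have h2 := natDegree_sub_le B (C (a 0) * X * A)
      rcases hA with rfl | hA
      · simp; omega
      · have := max_le (a := B.natDegree) (b := (C (a 0) * X * A).natDegree) (c := (L + 1) / 2)
          (by omega) (by omega)
        omega
    · simp [hB0, mul_assoc]
    · rw [hcoe, hfac]
      linear_combination J * (1 - PowerSeries.C (a 0) * PowerSeries.X * (I * (A : ℝ⟦X⟧))) * hIB + hJS
    · have : I * J * (B : ℝ⟦X⟧) = J := by linear_combination J * hIB
      rwa [this]
    · rw [hcoe, Finset.prod_range_succ', map_mul, pow_succ]
      simp only [zero_add] at hF'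
      have := hF 0
      simp only [zero_add] at this
      linear_combination PowerSeries.C (a 0) * PowerSeries.X * hF' + (B : ℝ⟦X⟧) * this

/-! ### Hypergeometric series and the Gauss continued fraction -/

/-- The rising factorial `(a)_n`. -/
noncomputable def risingFact (a : ℝ) (n : ℕ) : ℝ := (ascPochhammer ℝ n).eval a

@[simp] theorem risingFact_zero (a : ℝ) : risingFact a 0 = 1 := by simp [risingFact]

theorem risingFact_succ (a : ℝ) (n : ℕ) : risingFact a (n + 1) = risingFact a n * (a + n) :=
  ascPochhammer_succ_eval n a

theorem risingFact_succ_left (a : ℝ) (n : ℕ) :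
    risingFact a (n + 1) = a * risingFact (a + 1) n := by
  simp [risingFact, ascPochhammer_succ_left, eval_comp]

theorem risingFact_pos {a : ℝ} (ha : 0 < a) (n : ℕ) : 0 < risingFact a n :=
  ascPochhammer_pos n a ha

theorem risingFact_one (n : ℕ) : risingFact 1 n = n.factorial := by
  simp [risingFact, ascPochhammer_eval_one]

theorem risingFact_add (a : ℝ) (m n : ℕ) :
    risingFact a (m + n) = risingFact a m * risingFact (a + m) n := by
  induction n with
  | zero => simp
  | succ n ih => rw [← add_assoc, risingFact_succ, risingFact_succ, ih]; push_cast; ring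

/-- The Gauss hypergeometric series `₂F₁(a, b; c; X)`. -/
noncomputable def hypSeries (a b c : ℝ) : ℝ⟦X⟧ :=
  PowerSeries.mk fun n => risingFact a n * risingFact b n / (risingFact c n * n.factorial)

theorem hypSeries_comm (a b c : ℝ) : hypSeries a b c = hypSeries b a c := by
  simp only [hypSeries, mul_comm]

theorem hypSeries_contiguous {c : ℝ} (hc : 0 < c) (a b : ℝ) :
    hypSeries a (b + 1) (c + 1) = hypSeries a b c +
      PowerSeries.C (a * (c - b) / (c * (c + 1))) * PowerSeries.X *
        hypSeries (a + 1) (b + 1) (c + 2) := by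
  ext n
  rw [map_add, mul_assoc, PowerSeries.coeff_C_mul]
  cases n with
  | zero => simp [hypSeries]
  | succ n =>
    rw [PowerSeries.coeff_succ_X_mul]
    simp only [hypSeries, PowerSeries.coeff_mk]
    have e1 := risingFact_succ (c + 1) n
    have e2 := risingFact_succ_left (c + 1) n
    rw [show c + 1 + 1 = c + 2 by ring] at e2
    have h1 := risingFact_pos (show 0 < c + 1 by linarith) n
    have h2 : risingFact (c + 2) n = risingFact (c + 1) n * (c + 1 + n) / (c + 1) := by
      field_simp; linarith
    have h3 : (0 : ℝ) < n.factorial := by positivity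
    have h4 : (0 : ℝ) < c + 1 + n := by positivity
    rw [e1, h2, risingFact_succ_left c, risingFact_succ_left a, risingFact_succ_left b,
      risingFact_succ (b + 1), Nat.factorial_succ]
    push_cast
    field_simp
    ring

/-- The case b = 0 of the contiguous relation, with c cancelled so that c = 0 is allowed; this value
occurs when m = k + 1. -/
theorem hypSeries_contiguous_zero {c : ℝ} (hc : 0 ≤ c) (a : ℝ) :
    hypSeries a 1 (c + 1) = hypSeries a 0 c +
      PowerSeries.C (a / (c + 1)) * PowerSeries.X * hypSeries (a + 1) 1 (c + 2) := by
  ext n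
  rw [map_add, mul_assoc, PowerSeries.coeff_C_mul]
  cases n with
  | zero => simp [hypSeries]
  | succ n =>
    rw [PowerSeries.coeff_succ_X_mul]
    simp only [hypSeries, PowerSeries.coeff_mk]
    have h1 := risingFact_pos (show 0 < c + 1 + 1 by linarith) n
    have h3 : (0 : ℝ) < n.factorial := by positivity
    rw [risingFact_succ_left (c + 1), risingFact_succ_left a, risingFact_succ_left 0,
      risingFact_one, risingFact_one, show c + 2 = c + 1 + 1 by ring]
    field_simp
    simp

/-- All later numerators contain (0)_n = 0, so even c = 0 is harmless: there 0/0 = 0. -/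
theorem hypSeries_zero (a c : ℝ) : hypSeries a 0 c = 1 := by
  ext n
  cases n <;> simp [hypSeries, risingFact_succ_left 0, PowerSeries.coeff_one]

/-- The sequence of hypergeometric series in the Gauss continued fraction of `₂F₁(a, 1; c + 1)`. -/
noncomputable def gaussSeq (a c : ℝ) (j : ℕ) : ℝ⟦X⟧ :=
  hypSeries (a + (j / 2 : ℕ)) ((j + 1) / 2 : ℕ) (c + j)

/-- The coefficients of the Gauss continued fraction of `₂F₁(a, 1; c + 1)`. -/
noncomputable def gaussCoeff (a c : ℝ) (j : ℕ) : ℝ :=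
  if j = 0 then a / (c + 1)
  else if Even j then (a + (j / 2 : ℕ)) * (c + (j / 2 : ℕ)) / ((c + j) * (c + j + 1))
  else ((j + 1) / 2 : ℕ) * (c - a + ((j + 1) / 2 : ℕ)) / ((c + j) * (c + j + 1))

/-- The upper parameters are raised alternately; odd steps use the contiguous relation with the two
exchanged. -/
theorem gaussSeq_rec {c : ℝ} (hc : 0 ≤ c) (a : ℝ) (j : ℕ) :
    gaussSeq a c (j + 1) = gaussSeq a c j +
      PowerSeries.C (gaussCoeff a c j) * PowerSeries.X * gaussSeq a c (j + 2) := by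
  rcases Nat.even_or_odd' j with ⟨i, rfl | rfl⟩
  · rcases Nat.eq_zero_or_pos i with rfl | hi
    · simpa [gaussSeq, gaussCoeff] using hypSeries_contiguous_zero hc a
    · have hi' : (0 : ℝ) < i := by exact_mod_cast hi
      have := hypSeries_contiguous (c := c + 2 * i) (by positivity) (a + i) i
      simp only [gaussSeq, gaussCoeff]
      rw [if_neg (by omega), if_pos (by simp), show (2 * i + 1) / 2 = i by omega,
        show (2 * i) / 2 = i by omega, show (2 * i + 2) / 2 = i + 1 by omega,
        show (2 * i + 2 + 1) / 2 = i + 1 by omega]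
      push_cast
      convert this using 2
      · ring_nf
      · congr 1
        · congr 2; ring_nf
        · ring_nf
  · have := hypSeries_contiguous (c := c + 2 * i + 1) (by positivity) (i + 1) (a + i)
    simp only [gaussSeq, gaussCoeff]
    rw [if_neg (by omega), if_neg (by simp), show (2 * i + 1 + 1) / 2 = i + 1 by omega,
      show (2 * i + 1) / 2 = i by omega, show (2 * i + 1 + 2) / 2 = i + 1 by omega,
      show (2 * i + 1 + 2 + 1) / 2 = i + 2 by omega,
      hypSeries_comm, hypSeries_comm (a + i), hypSeries_comm (a + (i + 1 : ℕ))]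
    push_cast
    convert this using 2
    · ring_nf
    · ring_nf
    · ring_nf
    · congr 1
      · congr 2; ring_nf
      · ring_nf

theorem gaussCoeff_nonneg {a c : ℝ} (ha : 0 ≤ a) (hc : 0 ≤ c) (hac : a ≤ c + 1) (j : ℕ) :
    0 ≤ gaussCoeff a c j := by
  unfold gaussCoeff
  split_ifs with h0 h1
  · positivity
  · positivity
  · have : (1 : ℝ) ≤ ((j + 1) / 2 : ℕ) := by exact_mod_cast (by omega : 1 ≤ (j + 1) / 2)
    have : 0 ≤ c - a + ((j + 1) / 2 : ℕ) := by linarith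
    positivity

/-! ### Binomial series and the formal Padé approximant -/

/-- The binomial series of `(1 - X)^(-s)`. -/
noncomputable def negBinomSeries (s : ℝ) : ℝ⟦X⟧ :=
  PowerSeries.mk fun n => risingFact s n / n.factorial

/-- The tail is hypergeometric because (s)_{c+d} = (s)_c (s+c)_d and (c+d)! = c! (c+1)_d. -/
theorem negBinomSeries_eq (s : ℝ) (c : ℕ) :
    negBinomSeries s = (PowerSeries.trunc c (negBinomSeries s) : ℝ⟦X⟧) +
      PowerSeries.C (risingFact s c / c.factorial) * PowerSeries.X ^ c *
        hypSeries (c + s) 1 (c + 1) := by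
  ext n
  rw [map_add, Polynomial.coeff_coe, PowerSeries.coeff_trunc, mul_assoc, PowerSeries.coeff_C_mul,
    PowerSeries.coeff_X_pow_mul']
  rcases lt_or_ge n c with h | h
  · simp [h, not_le.2 h]
  · obtain ⟨d, rfl⟩ := Nat.exists_eq_add_of_le h
    have h1 := risingFact_pos (show (0 : ℝ) < c + 1 by positivity) d
    have h2 : ((c + d).factorial : ℝ) = c.factorial * risingFact (c + 1) d := by
      rw [← risingFact_one, risingFact_add, risingFact_one, add_comm]
    simp only [h, not_lt.2 h, if_true, if_false, zero_add, negBinomSeries, hypSeries,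
      PowerSeries.coeff_mk, Nat.add_sub_cancel_left]
    rw [h2, risingFact_add, risingFact_one, add_comm s]
    field_simp

/-- The leading error coefficient for type [c+m / m+1]; with s = 1/p it is α/p. Raising m by one
brings in two more continued fraction coefficients. -/
theorem prod_gaussCoeff {s : ℝ} (c m : ℕ) :
    risingFact s c / c.factorial * ∏ j ∈ Finset.range (2 * (m + 1)), gaussCoeff (c + s) c j =
      (c + m).factorial * (m + 1).factorial * risingFact s (c + m + 1) *
        risingFact (1 - s) (m + 1) /
        ((c + m + (m + 1)).factorial * (c + m + (m + 1) + 1).factorial) := by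
  induction m with
  | zero =>
    simp only [gaussCoeff, mul_add, Finset.prod_range_succ, risingFact_succ]
    simp [Nat.factorial_succ]
    field_simp
    ring
  | succ m ih =>
    rw [show 2 * (m + 1 + 1) = 2 * (m + 1) + 1 + 1 by ring, Finset.prod_range_succ,
      Finset.prod_range_succ, ← mul_assoc, ← mul_assoc, ih]
    rw [gaussCoeff, if_neg (by omega), if_pos (by simp), gaussCoeff, if_neg (by omega),
      if_neg (by grind), show (2 * (m + 1)) / 2 = m + 1 by omega,
      show (2 * (m + 1) + 1 + 1) / 2 = m + 2 by omega, risingFact_succ (1 - s) (m + 1),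
      ← add_assoc c m 1, risingFact_succ s (c + m + 1),
      show c + m + 1 + (m + 1 + 1) = c + m + (m + 1) + 1 + 1 by ring]
    simp only [Nat.factorial_succ (c + m + (m + 1) + 1 + 1), Nat.factorial_succ (c + m + (m + 1) + 1),
      Nat.factorial_succ (c + m + (m + 1)), Nat.factorial_succ (c + m), Nat.factorial_succ (m + 1)]
    have h3 : (0 : ℝ) < (c + m + (m + 1)).factorial := by positivity
    push_cast
    field_simp
    ring

theorem padeAlpha_eq (p k m : ℕ) : padeAlpha p k m = p * k.factorial * m.factorial *
    risingFact (1 / p) (k + 1) * risingFact (1 - 1 / p) m /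
      ((k + m).factorial * (k + m + 1).factorial) := rfl

theorem NonnegCoeff.coeff_le_coeff_mul {A B : ℝ⟦X⟧} (hA : NonnegCoeff A)
    (hA0 : PowerSeries.constantCoeff A = 1) (hB : NonnegCoeff B) (n : ℕ) :
    PowerSeries.coeff n B ≤ PowerSeries.coeff n (A * B) := by
  have hmem : ((0, n) : ℕ × ℕ) ∈ Finset.HasAntidiagonal.antidiagonal n :=
    Finset.HasAntidiagonal.mem_antidiagonal.2 (zero_add n)
  have := Finset.single_le_sum
    (f := fun x : ℕ × ℕ => PowerSeries.coeff x.1 A * PowerSeries.coeff x.2 B)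
    (fun x _ => mul_nonneg (hA _) (hB _)) hmem
  rw [PowerSeries.coeff_mul]
  simpa [hA0] using this

theorem coe_natCast_powerSeries (n : ℕ) : (((n : ℝ[X])) : ℝ⟦X⟧) = (n : ℝ⟦X⟧) :=
  map_natCast (Polynomial.coeToPowerSeries.ringHom (R := ℝ)) n

theorem padeAlpha_pos {p : ℕ} (hp : 2 ≤ p) (k m : ℕ) : 0 < padeAlpha p k m := by
  have hp' : (2 : ℝ) ≤ p := by exact_mod_cast hp
  have h1 := risingFact_pos (show (0 : ℝ) < 1 / p by positivity) (k + 1)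
  have h2 := risingFact_pos (show (0 : ℝ) < 1 - 1 / p by
    rw [sub_pos, div_lt_one (by linarith)]; linarith) m
  rw [padeAlpha_eq]
  positivity

theorem negBinomSeries_nonneg {s : ℝ} (hs : 0 < s) : NonnegCoeff (negBinomSeries s) := fun n => by
  have := risingFact_pos hs n
  rw [negBinomSeries, PowerSeries.coeff_mk]
  positivity

/-- Existence of the Padé approximant `P / Q` of `(1 - X)^(-1/p)` as a formal power series, together
with positivity of the coefficients of `1 / Q` and `P / Q`, and the leading error coefficient. -/
theorem exists_formal_pade {p k m : ℕ} (hp : 2 ≤ p) (hkm : m ≤ k + 1) :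
    ∃ (P Q : ℝ[X]) (I E : ℝ⟦X⟧), P.natDegree ≤ k ∧ Q.natDegree ≤ m ∧ Q.coeff 0 = 1 ∧
      NonnegCoeff I ∧ I * (Q : ℝ⟦X⟧) = 1 ∧ NonnegCoeff (I * (P : ℝ⟦X⟧)) ∧
      (Q : ℝ⟦X⟧) * negBinomSeries (1 / p) - (P : ℝ⟦X⟧) = PowerSeries.X ^ (k + m + 1) * E ∧
      p * PowerSeries.constantCoeff E = padeAlpha p k m := by
  have hp' : (2 : ℝ) ≤ p := by exact_mod_cast hp
  -- c is the number of Taylor terms split off; k ≥ m - 1 is what makes it a natural number.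
  obtain ⟨c, hc⟩ : ∃ c, k + 1 = c + m := ⟨k + 1 - m, by omega⟩
  set s : ℝ := 1 / p with hs
  have hs0 : 0 < s := by positivity
  have hs1 : s ≤ 1 := by rw [hs, div_le_one (by linarith)]; linarith
  set γ : ℝ := risingFact s c / c.factorial with hγ
  have hγ0 : 0 ≤ γ := by have := risingFact_pos hs0 c; positivity
  obtain ⟨A, B, I, hB, hA, hB0, hI, hIB, hIA, hAB⟩ := exists_convergent (2 * m)
    (gaussSeq (c + s) c) (gaussCoeff (c + s) c)
    (gaussCoeff_nonneg (by positivity) (by positivity) (by linarith))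
    (gaussSeq_rec (by positivity) _)
  have hg0 : gaussSeq (c + s) c 0 = 1 := by simp [gaussSeq, hypSeries_zero]
  have hg1 : gaussSeq (c + s) c 1 = hypSeries (c + s) 1 (c + 1) := by simp [gaussSeq]
  rw [hg0, hg1, one_mul] at hAB
  have hF := negBinomSeries_eq s c
  rw [← hγ] at hF
  set T := PowerSeries.trunc c (negBinomSeries s) with hT
  have hcoe : ((T * B + C γ * X ^ c * A : ℝ[X]) : ℝ⟦X⟧) =
      (T : ℝ⟦X⟧) * (B : ℝ⟦X⟧) + PowerSeries.C γ * PowerSeries.X ^ c * (A : ℝ⟦X⟧) := by simp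
  -- The numerator of T + γ X^c A/B. Its degree is at most c - 1 + m = k, and 2m steps of the
  -- fraction give contact of order c + 2m = k + m + 1.
  refine ⟨T * B + C γ * X ^ c * A, B, I,
    PowerSeries.C (γ * ∏ j ∈ Finset.range (2 * m), gaussCoeff (c + s) c j) *
      gaussSeq (c + s) c (2 * m + 1), ?_, by omega, hB0, hI, hIB, ?_, ?_, ?_⟩
  · refine natDegree_add_le_of_degree_le ?_ ?_
    · rcases c with _ | c
      · simp [hT]
      · have := PowerSeries.natDegree_trunc_lt (negBinomSeries s) c
        rw [← hT] at this
        exact natDegree_mul_le.trans (by omega)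
    · rcases hA with rfl | hA
      · simp
      · refine natDegree_mul_le.trans ?_
        have := natDegree_C_mul_X_pow_le γ c
        omega
  · rw [hcoe]
    have : I * ((T : ℝ⟦X⟧) * (B : ℝ⟦X⟧) + PowerSeries.C γ * PowerSeries.X ^ c * (A : ℝ⟦X⟧)) =
        (T : ℝ⟦X⟧) + PowerSeries.C γ * PowerSeries.X ^ c * (I * (A : ℝ⟦X⟧)) := by
      linear_combination (T : ℝ⟦X⟧) * hIB
    rw [this]
    refine NonnegCoeff.add (fun n => ?_) (((NonnegCoeff.C hγ0).mul (NonnegCoeff.X.pow c)).mul hIA)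
    rw [Polynomial.coeff_coe, PowerSeries.coeff_trunc]
    split_ifs
    exacts [negBinomSeries_nonneg hs0 n, le_rfl]
  · rw [hcoe, show k + m + 1 = c + 2 * m by omega, pow_add, map_mul]
    linear_combination (B : ℝ⟦X⟧) * hF + PowerSeries.C γ * PowerSeries.X ^ c * hAB
  · have h1 : PowerSeries.constantCoeff (gaussSeq (c + s) c (2 * m + 1)) = 1 := by
      rw [← PowerSeries.coeff_zero_eq_constantCoeff_apply]
      simp [gaussSeq, hypSeries]
    rw [map_mul, h1, mul_one, PowerSeries.constantCoeff_C, padeAlpha_eq, ← hs]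
    rcases m with _ | m
    · obtain rfl : c = k + 1 := by omega
      simp [hγ]
      field_simp
    · obtain rfl : k = c + m := by omega
      rw [hγ, prod_gaussCoeff]
      ring

/-! ### Differential equation, Wronskian and residual -/

theorem negBinomSeries_ode {p : ℕ} (hp : 2 ≤ p) :
    negBinomSeries (1 / p) =
      (p : ℝ⟦X⟧) * (1 - PowerSeries.X) * PowerSeries.derivative ℝ (negBinomSeries (1 / p)) := by
  have hp' : (2 : ℝ) ≤ p := by exact_mod_cast hp
  have hcast : (p : ℝ⟦X⟧) = PowerSeries.C (p : ℝ) := by simp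
  ext n
  rw [hcast, mul_assoc, PowerSeries.coeff_C_mul, sub_mul, one_mul, map_sub]
  cases n with
  | zero =>
    simp [negBinomSeries, PowerSeries.coeff_derivative, risingFact_succ]
    field_simp
  | succ n =>
    rw [PowerSeries.coeff_succ_X_mul]
    simp only [negBinomSeries, PowerSeries.coeff_derivative, PowerSeries.coeff_mk,
      risingFact_succ _ (n + 1), Nat.factorial_succ (n + 1)]
    have : (0 : ℝ) < (n + 1).factorial := by positivity
    push_cast
    field_simp
    ring

/-- The Wronskian-type identity satisfied by the Padé approximant. -/
theorem pade_wronskian {p k m : ℕ} (hp : 2 ≤ p) {P Q : ℝ[X]} {E : ℝ⟦X⟧} (hP : P.natDegree ≤ k)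
    (hQ : Q.natDegree ≤ m) (hQ0 : Q.coeff 0 = 1)
    (h : (Q : ℝ⟦X⟧) * negBinomSeries (1 / p) - (P : ℝ⟦X⟧) = PowerSeries.X ^ (k + m + 1) * E) :
    P * Q - (p : ℝ[X]) * (1 - X) * (derivative P * Q - P * derivative Q) =
      C ((k + m + 1) * (p * PowerSeries.constantCoeff E)) * X ^ (k + m) := by
  set F := negBinomSeries (1 / p)
  have hode : F = (p : ℝ⟦X⟧) * (1 - PowerSeries.X) * PowerSeries.derivative ℝ F :=
    negBinomSeries_ode hp
  set W := P * Q - (p : ℝ[X]) * (1 - X) * (derivative P * Q - P * derivative Q) with hW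
  have hdeg : W.natDegree ≤ k + m := by
    -- Differentiation lowers the degree by one, which pays for the factor 1 - X.
    have hX : ∀ A : ℝ[X], ((1 - X) * derivative A).natDegree ≤ A.natDegree := fun A => by
      rcases Nat.eq_zero_or_pos A.natDegree with h0 | h0
      · rw [derivative_of_natDegree_zero h0]; simp
      · have := natDegree_derivative_lt h0.ne'
        have h2 : (1 - X : ℝ[X]).natDegree ≤ 1 := (natDegree_sub_le _ _).trans (by simp)
        exact natDegree_mul_le.trans (by omega)
    have e : W = P * Q - C (p : ℝ) * (((1 - X) * derivative P) * Q - P * ((1 - X) * derivative Q)) := by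
      rw [hW, C_eq_natCast]; ring
    have h1 := hX P
    have h2 := hX Q
    rw [e]
    refine (natDegree_sub_le_of_le (natDegree_mul_le_of_le hP hQ)
      ((natDegree_C_mul_le _ _).trans (natDegree_sub_le_of_le
        (natDegree_mul_le_of_le (h1.trans hP) hQ) (natDegree_mul_le_of_le hP (h2.trans hQ))))).trans ?_
    simp
  have hP' : (P : ℝ⟦X⟧) = (Q : ℝ⟦X⟧) * F - PowerSeries.X ^ (k + m + 1) * E := by
    linear_combination -h
  have hDP : ((derivative P : ℝ[X]) : ℝ⟦X⟧) = (Q : ℝ⟦X⟧) * PowerSeries.derivative ℝ F +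
      F * ((derivative Q : ℝ[X]) : ℝ⟦X⟧) -
      (PowerSeries.X ^ (k + m + 1) * PowerSeries.derivative ℝ E +
        E * (((k + m + 1 : ℕ) : ℝ⟦X⟧) * PowerSeries.X ^ (k + m))) := by
    rw [← PowerSeries.derivative_coe, hP', ← PowerSeries.derivative_coe, map_sub,
      Derivation.leibniz, Derivation.leibniz, PowerSeries.derivative_pow, PowerSeries.derivative_X]
    simp
  -- After substituting P = Q F - X^(k+m+1) E, the part free of E cancels by the differential
  -- equation.
  have hWX : (W : ℝ⟦X⟧) = PowerSeries.X ^ (k + m) *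
      (-(PowerSeries.X * E * (Q : ℝ⟦X⟧)) + (p : ℝ⟦X⟧) * (1 - PowerSeries.X) *
        (((k + m + 1 : ℕ) : ℝ⟦X⟧) * E * (Q : ℝ⟦X⟧) +
          PowerSeries.X * PowerSeries.derivative ℝ E * (Q : ℝ⟦X⟧) -
          PowerSeries.X * E * ((derivative Q : ℝ[X]) : ℝ⟦X⟧))) := by
    have : (W : ℝ⟦X⟧) = (P : ℝ⟦X⟧) * (Q : ℝ⟦X⟧) - (p : ℝ⟦X⟧) * (1 - PowerSeries.X) *
        (((derivative P : ℝ[X]) : ℝ⟦X⟧) * (Q : ℝ⟦X⟧) -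
          (P : ℝ⟦X⟧) * ((derivative Q : ℝ[X]) : ℝ⟦X⟧)) := by
      simp [hW, coe_natCast_powerSeries]
    rw [this, hDP, hP']
    linear_combination (Q : ℝ⟦X⟧) ^ 2 * hode
  ext i
  rw [coeff_C_mul_X_pow]
  rcases lt_trichotomy i (k + m) with hi | rfl | hi
  · rw [if_neg hi.ne, ← Polynomial.coeff_coe, hWX, PowerSeries.coeff_X_pow_mul', if_neg (by omega)]
  · have hQc : PowerSeries.constantCoeff (Q : ℝ⟦X⟧) = 1 := by
      rw [← PowerSeries.coeff_zero_eq_constantCoeff_apply, Polynomial.coeff_coe, hQ0]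
    rw [if_pos rfl, ← Polynomial.coeff_coe, hWX, PowerSeries.coeff_X_pow_mul', if_pos le_rfl,
      Nat.sub_self, PowerSeries.coeff_zero_eq_constantCoeff_apply]
    simp only [map_add, map_neg, map_mul, map_sub, map_natCast, PowerSeries.constantCoeff_X, hQc,
      map_one]
    push_cast
    ring
  · rw [if_neg hi.ne', coeff_eq_zero_of_natDegree_lt (by omega)]

/-- The formal residual `1 - (1 - X) R^p`. -/
noncomputable def formalResidual (p : ℕ) (R : ℝ⟦X⟧) : ℝ⟦X⟧ := 1 - (1 - PowerSeries.X) * R ^ p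

/-- Here f' = R^(p-1) (R - p(1-X)R'), and Q^2 times the bracket is W. -/
theorem derivative_formalResidual {p : ℕ} (hp : 2 ≤ p) {P Q W : ℝ[X]} {I : ℝ⟦X⟧}
    (hI : I * (Q : ℝ⟦X⟧) = 1)
    (hW : P * Q - (p : ℝ[X]) * (1 - X) * (derivative P * Q - P * derivative Q) = W) :
    PowerSeries.derivative ℝ (formalResidual p (I * (P : ℝ⟦X⟧))) =
      (W : ℝ⟦X⟧) * ((I * (P : ℝ⟦X⟧)) ^ (p - 1) * I ^ 2) := by
  set R := I * (P : ℝ⟦X⟧) with hR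
  have hRQ : R * (Q : ℝ⟦X⟧) = (P : ℝ⟦X⟧) := by rw [hR]; linear_combination (P : ℝ⟦X⟧) * hI
  have hD := congrArg (PowerSeries.derivative ℝ) hRQ
  rw [Derivation.leibniz, PowerSeries.derivative_coe, PowerSeries.derivative_coe] at hD
  simp only [smul_eq_mul] at hD
  have hWX : (W : ℝ⟦X⟧) = (P : ℝ⟦X⟧) * (Q : ℝ⟦X⟧) - (p : ℝ⟦X⟧) * (1 - PowerSeries.X) *
      (((derivative P : ℝ[X]) : ℝ⟦X⟧) * (Q : ℝ⟦X⟧) -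
        (P : ℝ⟦X⟧) * ((derivative Q : ℝ[X]) : ℝ⟦X⟧)) := by
    simp [← hW, coe_natCast_powerSeries]
  have hkey : R - (p : ℝ⟦X⟧) * (1 - PowerSeries.X) * PowerSeries.derivative ℝ R =
      (W : ℝ⟦X⟧) * I ^ 2 := by
    have hQ2 : (W : ℝ⟦X⟧) = (Q : ℝ⟦X⟧) ^ 2 *
        (R - (p : ℝ⟦X⟧) * (1 - PowerSeries.X) * PowerSeries.derivative ℝ R) := by
      rw [hWX, ← hD, ← hRQ]; ring
    rw [hQ2]
    linear_combination -(R - (p : ℝ⟦X⟧) * (1 - PowerSeries.X) * PowerSeries.derivative ℝ R) *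
      (I * (Q : ℝ⟦X⟧) + 1) * hI
  obtain ⟨q, rfl⟩ : ∃ q, p = q + 1 := ⟨p - 1, by omega⟩
  rw [formalResidual, map_sub, Derivation.leibniz, PowerSeries.derivative_pow, map_sub,
    PowerSeries.derivative_X, PowerSeries.derivative_one]
  simp only [smul_eq_mul, Nat.add_sub_cancel] at hkey ⊢
  linear_combination R ^ q * hkey

/-- Multiplication by 1 - X takes differences of coefficients, so the sums telescope. -/
theorem sum_coeff_formalResidual (p : ℕ) (R : ℝ⟦X⟧) (n : ℕ) :
    ∑ i ∈ Finset.range (n + 1), PowerSeries.coeff i (formalResidual p R) =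
      1 - PowerSeries.coeff n (R ^ p) := by
  induction n with
  | zero => simp [formalResidual]
  | succ n ih =>
    rw [Finset.sum_range_succ, ih, formalResidual, sub_mul, one_mul, map_sub, map_sub,
      PowerSeries.coeff_succ_X_mul, PowerSeries.coeff_one]
    simp

/-- The real Padé approximant `P / Q` of `(1 - X)^(-1/p)` and its residual series. -/
theorem exists_pade_residual {p k m : ℕ} (hp : 2 ≤ p) (hkm : m ≤ k + 1) (hpos : 1 ≤ k + m) :
    ∃ (P Q : ℝ[X]) (R : ℝ⟦X⟧), P.natDegree ≤ k ∧ Q.natDegree ≤ m ∧ Q.coeff 0 = 1 ∧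
      (∃ c : ℝ, c ≠ 0 ∧
        P * Q - (p : ℝ[X]) * (1 - X) * (derivative P * Q - P * derivative Q) = C c * X ^ (k + m)) ∧
      R * (Q : ℝ⟦X⟧) = (P : ℝ⟦X⟧) ∧ NonnegCoeff R ∧ (∀ n, PowerSeries.coeff n R ≤ 1) ∧
      (∀ n < k + m + 1, PowerSeries.coeff n R = PowerSeries.coeff n (negBinomSeries (1 / p))) ∧
      NonnegCoeff (formalResidual p R) ∧
      (∀ n, ∑ i ∈ Finset.range n, PowerSeries.coeff i (formalResidual p R) ≤ 1) ∧
      (∀ n < k + m + 1, PowerSeries.coeff n (formalResidual p R) = 0) ∧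
      PowerSeries.coeff (k + m + 1) (formalResidual p R) = padeAlpha p k m ∧
      0 < PowerSeries.coeff (k + m + 2) (formalResidual p R) := by
  obtain ⟨P, Q, I, E, hP, hQ, hQ0, hI, hIQ, hR, hE, hα⟩ := exists_formal_pade hp hkm
  have hW := pade_wronskian hp hP hQ hQ0 hE
  rw [hα] at hW
  have hα0 := padeAlpha_pos hp k m
  have hc0 : 0 < ((k : ℝ) + m + 1) * padeAlpha p k m := by positivity
  have hDf := derivative_formalResidual hp hIQ hW
  set R := I * (P : ℝ⟦X⟧) with hRdef
  have hRQ : R * (Q : ℝ⟦X⟧) = (P : ℝ⟦X⟧) := by rw [hRdef]; linear_combination (P : ℝ⟦X⟧) * hIQ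
  have hRF : R = negBinomSeries (1 / p) - PowerSeries.X ^ (k + m + 1) * (I * E) := by
    linear_combination -I * hE + negBinomSeries (1 / p) * hIQ
  have hcoeffR : ∀ n < k + m + 1,
      PowerSeries.coeff n R = PowerSeries.coeff n (negBinomSeries (1 / p)) := fun n hn => by
    rw [hRF, map_sub, PowerSeries.coeff_X_pow_mul', if_neg (by omega), sub_zero]
  have hR0 : PowerSeries.constantCoeff R = 1 := by
    rw [← PowerSeries.coeff_zero_eq_constantCoeff_apply, hcoeffR 0 (by omega)]
    simp [negBinomSeries]
  have hI0 : PowerSeries.constantCoeff I = 1 := by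
    have := congrArg PowerSeries.constantCoeff hIQ
    rwa [map_mul, ← PowerSeries.coeff_zero_eq_constantCoeff_apply (Q : ℝ⟦X⟧),
      Polynomial.coeff_coe, hQ0, mul_one, map_one] at this
  have hcoef : ∀ n, PowerSeries.coeff (n + 1) (formalResidual p R) * ((n : ℝ) + 1) =
      if k + m ≤ n then ((k : ℝ) + m + 1) * padeAlpha p k m *
        PowerSeries.coeff (n - (k + m)) (R ^ (p - 1) * I ^ 2) else 0 := fun n => by
    have hcoe : ((C (((k : ℝ) + m + 1) * padeAlpha p k m) * X ^ (k + m) : ℝ[X]) : ℝ⟦X⟧) =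
        PowerSeries.C (((k : ℝ) + m + 1) * padeAlpha p k m) * PowerSeries.X ^ (k + m) := by
      rw [Polynomial.coe_mul, Polynomial.coe_C, Polynomial.coe_pow, Polynomial.coe_X]
    rw [← PowerSeries.coeff_derivative, hDf, hcoe, mul_assoc, PowerSeries.coeff_C_mul,
      PowerSeries.coeff_X_pow_mul']
    split_ifs <;> simp
  have hf0 : PowerSeries.coeff 0 (formalResidual p R) = 0 := by
    simp [formalResidual, hR0]
  have hRI : NonnegCoeff (R ^ (p - 1) * I ^ 2) := (hR.pow _).mul (hI.pow _)
  have hf : NonnegCoeff (formalResidual p R) := fun n => by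
    rcases n with _ | n
    · exact hf0.ge
    · have h1 : (0 : ℝ) < n + 1 := by positivity
      refine nonneg_of_mul_nonneg_left (b := (n : ℝ) + 1) ?_ h1
      rw [hcoef]
      split_ifs
      · exact mul_nonneg hc0.le (hRI _)
      · exact le_rfl
  -- R^(p-1) is nonnegative with constant term 1, so a bound on the coefficients of R^p passes to R.
  have hRp : ∀ n, PowerSeries.coeff n R ≤ PowerSeries.coeff n (R ^ p) := fun n => by
    obtain ⟨q, rfl⟩ : ∃ q, p = q + 1 := ⟨p - 1, by omega⟩
    rw [pow_succ]
    exact (hR.pow q).coeff_le_coeff_mul (by simp [hR0]) hR n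
  have hsum := sum_coeff_formalResidual p R
  refine ⟨P, Q, R, hP, hQ, hQ0, ⟨_, hc0.ne', hW⟩, hRQ, hR, fun n => ?_, hcoeffR, hf, fun n => ?_,
    fun n hn => ?_, ?_, ?_⟩
  · have h1 := hsum n
    have h2 := Finset.sum_nonneg fun i (_ : i ∈ Finset.range (n + 1)) => hf i
    linarith [hRp n]
  · rcases n with _ | n
    · simp
    · rw [hsum]; linarith [hR.pow p n]
  · rcases n with _ | n
    · exact hf0
    · have := hcoef n
      rw [if_neg (by omega)] at this
      exact (mul_eq_zero.1 this).resolve_right (by positivity)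
  · have := hcoef (k + m)
    rw [if_pos le_rfl, Nat.sub_self, PowerSeries.coeff_zero_eq_constantCoeff_apply] at this
    simp only [map_mul, map_pow, hR0, hI0, one_pow, mul_one] at this
    push_cast at this
    have h1 : (0 : ℝ) < k + m + 1 := by positivity
    nlinarith [mul_right_cancel₀ h1.ne' (this.trans (mul_comm _ _))]
  · have := hcoef (k + m + 1)
    rw [if_pos (by omega), Nat.add_sub_cancel_left] at this
    -- The linear coefficient of R is that of F, namely 1/p, since k + m ≥ 1. The resulting second
    -- positive coefficient of f will make α < 1 strict.
    have h1 : 0 < PowerSeries.coeff 1 (R ^ (p - 1) * I ^ 2) := by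
      obtain ⟨q, rfl⟩ : ∃ q, p = q + 2 := ⟨p - 2, by omega⟩
      rw [show q + 2 - 1 = q + 1 by omega, pow_succ, mul_right_comm]
      have h3 : 0 < PowerSeries.coeff 1 R := by
        rw [hcoeffR 1 (by omega)]
        simp only [negBinomSeries, PowerSeries.coeff_mk, risingFact_succ]
        simp
        positivity
      exact h3.trans_le
        (((hR.pow q).mul (hI.pow 2)).coeff_le_coeff_mul (by simp [hR0, hI0]) hR 1)
    have h4 := mul_pos hc0 h1
    rw [← this] at h4
    exact pos_of_mul_pos_left h4 (by positivity)

/-! ### Evaluation of real power series at complex points -/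

/-- The real power series `A` converges absolutely at `z ∈ ℂ`, with sum `v`. -/
structure EvalsTo (A : ℝ⟦X⟧) (z v : ℂ) : Prop where
  summable_norm : Summable fun n => ‖((PowerSeries.coeff n A : ℝ) : ℂ) * z ^ n‖
  hasSum : HasSum (fun n => ((PowerSeries.coeff n A : ℝ) : ℂ) * z ^ n) v

namespace EvalsTo

variable {A B : ℝ⟦X⟧} {z v w : ℂ}

theorem unique (hv : EvalsTo A z v) (hw : EvalsTo A z w) : v = w := hv.hasSum.unique hw.hasSum

theorem polynomial (P : ℝ[X]) (z : ℂ) :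
    EvalsTo (P : ℝ⟦X⟧) z ((P.map Complex.ofRealHom).eval z) := by
  have h0 : ∀ n ∉ Finset.range (P.natDegree + 1),
      ((PowerSeries.coeff n (P : ℝ⟦X⟧) : ℝ) : ℂ) * z ^ n = 0 := fun n hn => by
    rw [Polynomial.coeff_coe, coeff_eq_zero_of_natDegree_lt (by simpa using hn)]
    simp
  constructor
  · exact summable_of_ne_finset_zero (s := Finset.range (P.natDegree + 1)) fun n hn => by
      rw [h0 n hn, norm_zero]
  · convert hasSum_sum_of_ne_finset_zero (L := .unconditional ℕ) h0 using 1
    rw [eval_map, eval₂_eq_sum_range]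
    simp

theorem one (z : ℂ) : EvalsTo 1 z 1 := by simpa using polynomial 1 z

theorem X (z : ℂ) : EvalsTo PowerSeries.X z z := by simpa using polynomial Polynomial.X z

theorem sub (hA : EvalsTo A z v) (hB : EvalsTo B z w) : EvalsTo (A - B) z (v - w) := by
  have e : ∀ n, ((PowerSeries.coeff n (A - B) : ℝ) : ℂ) * z ^ n =
      ((PowerSeries.coeff n A : ℝ) : ℂ) * z ^ n - ((PowerSeries.coeff n B : ℝ) : ℂ) * z ^ n :=
    fun n => by rw [map_sub]; push_cast; ring
  constructor
  · refine (hA.summable_norm.add hB.summable_norm).of_nonneg_of_le (fun _ => norm_nonneg _)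
      fun n => ?_
    rw [e]
    exact norm_sub_le _ _
  · simp only [e]
    exact hA.hasSum.sub hB.hasSum

theorem mul (hA : EvalsTo A z v) (hB : EvalsTo B z w) : EvalsTo (A * B) z (v * w) := by
  have e : ∀ n, ((PowerSeries.coeff n (A * B) : ℝ) : ℂ) * z ^ n =
      ∑ x ∈ Finset.HasAntidiagonal.antidiagonal n,
        (((PowerSeries.coeff x.1 A : ℝ) : ℂ) * z ^ x.1) *
          (((PowerSeries.coeff x.2 B : ℝ) : ℂ) * z ^ x.2) := fun n => by
    rw [PowerSeries.coeff_mul, Complex.ofReal_sum, Finset.sum_mul]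
    refine Finset.sum_congr rfl fun x hx => ?_
    rw [← Finset.HasAntidiagonal.mem_antidiagonal.1 hx]
    push_cast
    ring
  have hs := summable_norm_sum_mul_antidiagonal_of_summable_norm hA.summable_norm hB.summable_norm
  constructor
  · simpa only [e] using hs
  · simp only [e]
    rw [← hA.hasSum.tsum_eq, ← hB.hasSum.tsum_eq,
      tsum_mul_tsum_eq_tsum_sum_antidiagonal_of_summable_norm hA.summable_norm hB.summable_norm]
    exact hs.of_norm.hasSum

theorem pow (hA : EvalsTo A z v) (n : ℕ) : EvalsTo (A ^ n) z (v ^ n) := by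
  induction n with
  | zero => simpa using one z
  | succ n ih => rw [pow_succ, pow_succ]; exact ih.mul hA

theorem exists_of_abs_coeff_le_one (hA : ∀ n, |PowerSeries.coeff n A| ≤ 1) (hz : ‖z‖ < 1) :
    ∃ v, EvalsTo A z v ∧ ‖v‖ ≤ (1 - ‖z‖)⁻¹ := by
  have hle : ∀ n, ‖((PowerSeries.coeff n A : ℝ) : ℂ) * z ^ n‖ ≤ ‖z‖ ^ n := fun n => by
    rw [norm_mul, norm_pow, Complex.norm_real]
    exact mul_le_of_le_one_left (by positivity) (hA n)
  have hg := hasSum_geometric_of_lt_one (norm_nonneg z) hz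
  have hs := hg.summable.of_nonneg_of_le (fun _ => norm_nonneg _) hle
  exact ⟨_, ⟨hs, hs.of_norm.hasSum⟩, tsum_of_norm_bounded hg hle⟩

theorem formalResidual (hA : EvalsTo A z v) (p : ℕ) :
    EvalsTo (formalResidual p A) z (1 - (1 - z) * v ^ p) :=
  (one z).sub (((one z).sub (X z)).mul (hA.pow p))

/-- A power series with vanishing coefficients below `N` and all coefficients in `[-1, 1]` is
`O(z^N)`. -/
theorem norm_le_of_coeff_eq_zero {N : ℕ} (hA : EvalsTo A z v)
    (hA1 : ∀ n, |PowerSeries.coeff n A| ≤ 1) (hA0 : ∀ n < N, PowerSeries.coeff n A = 0)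
    (hz : ‖z‖ < 1) : ‖v‖ ≤ (1 - ‖z‖)⁻¹ * ‖z‖ ^ N := by
  obtain ⟨w, hw, hw1⟩ := exists_of_abs_coeff_le_one
    (A := PowerSeries.mk fun n => PowerSeries.coeff (n + N) A)
    (fun n => by rw [PowerSeries.coeff_mk]; exact hA1 _) hz
  have hfac : PowerSeries.X ^ N * (PowerSeries.mk fun n => PowerSeries.coeff (n + N) A) = A := by
    ext n
    rw [PowerSeries.coeff_X_pow_mul']
    split_ifs with h
    · rw [PowerSeries.coeff_mk, Nat.sub_add_cancel h]
    · rw [hA0 n (by omega)]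
  have := ((X z).pow N).mul hw
  rw [hfac] at this
  rw [hA.unique this, norm_mul, norm_pow, mul_comm]
  gcongr

/-- Schwarz-type bound for a power series with nonnegative coefficients of total mass at most `1`
that starts with `α z^N`. -/
theorem norm_le_of_nonneg {N : ℕ} {α : ℝ} (hA : EvalsTo A z v) (hnn : NonnegCoeff A)
    (hsum : ∀ n, ∑ i ∈ Finset.range n, PowerSeries.coeff i A ≤ 1)
    (h0 : ∀ n < N, PowerSeries.coeff n A = 0) (hN : PowerSeries.coeff N A = α) (hz : ‖z‖ ≤ 1) :
    ‖v‖ ≤ ‖z‖ ^ N * (‖z‖ + α * (1 - ‖z‖)) := by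
  have hs : Summable fun n => PowerSeries.coeff n A := summable_of_sum_range_le hnn hsum
  have hs1 : ∑' n, PowerSeries.coeff n A ≤ 1 := Real.tsum_le_of_sum_range_le hnn hsum
  -- Terms past N are bounded by a_n |z|^(N+1); the indicator term corrects this at n = N, where
  -- only |z|^N is available.
  have hbound := tsum_of_norm_bounded (f := fun n => ((PowerSeries.coeff n A : ℝ) : ℂ) * z ^ n)
    ((hs.hasSum.mul_right (‖z‖ ^ (N + 1))).add (hasSum_ite_eq N (α * (‖z‖ ^ N - ‖z‖ ^ (N + 1)))))
    (fun n => by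
      rw [norm_mul, norm_pow, Complex.norm_real, Real.norm_of_nonneg (hnn n)]
      split_ifs with h
      · subst h
        rw [hN]
        linarith
      · rcases lt_or_ge n N with h' | h'
        · simp [h0 n h']
        · rw [add_zero]
          exact mul_le_mul_of_nonneg_left
            (pow_le_pow_of_le_one (norm_nonneg z) hz (by omega)) (hnn n))
  rw [hA.hasSum.tsum_eq] at hbound
  have h1 : (∑' n, PowerSeries.coeff n A) * ‖z‖ ^ (N + 1) ≤ 1 * ‖z‖ ^ (N + 1) := by gcongr
  refine hbound.trans ((add_le_add_left h1 _).trans (le_of_eq ?_))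
  ring

end EvalsTo

theorem negBinomSeries_coeff_le_one {s : ℝ} (hs0 : 0 < s) (hs1 : s ≤ 1) (n : ℕ) :
    PowerSeries.coeff n (negBinomSeries s) ≤ 1 := by
  rw [negBinomSeries, PowerSeries.coeff_mk, div_le_one (by positivity)]
  induction n with
  | zero => simp
  | succ n ih =>
    rw [risingFact_succ, Nat.factorial_succ, mul_comm]
    push_cast
    have := risingFact_pos hs0 n
    exact mul_le_mul (by linarith) ih this.le (by positivity)

theorem ofReal_risingFact (a : ℝ) (n : ℕ) :
    ((risingFact a n : ℝ) : ℂ) = (ascPochhammer ℂ n).eval (a : ℂ) := by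
  induction n with
  | zero => simp
  | succ n ih => rw [risingFact_succ, ascPochhammer_succ_eval, ← ih]; push_cast; ring

theorem invRoot_evalsTo {p : ℕ} (hp : 2 ≤ p) {z : ℂ} (hz : ‖z‖ < 1) :
    EvalsTo (negBinomSeries (1 / p)) z (invRoot p z) := by
  have hp' : (2 : ℝ) ≤ p := by exact_mod_cast hp
  have hs0 : (0 : ℝ) < 1 / p := by positivity
  have hs1 : (1 : ℝ) / p ≤ 1 := by rw [div_le_one (by linarith)]; linarith
  obtain ⟨v, hv, -⟩ := EvalsTo.exists_of_abs_coeff_le_one (A := negBinomSeries (1 / p))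
    (fun n => by
      rw [abs_of_nonneg (negBinomSeries_nonneg hs0 n)]
      exact negBinomSeries_coeff_le_one hs0 hs1 n) hz
  have h := (Complex.one_div_one_sub_cpow_hasFPowerSeriesOnBall_zero (1 / (p : ℂ))).hasSum
    (y := z) (by simpa [enorm_eq_nnnorm, ← NNReal.coe_lt_one] using hz)
  have e : v = invRoot p z := by
    refine hv.hasSum.unique ?_
    rw [zero_add] at h
    rw [invRoot, Complex.cpow_neg, ← one_div]
    refine (funext fun n => ?_ : (fun n => ((PowerSeries.coeff n (negBinomSeries (1 / p)) : ℝ) : ℂ) *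
      z ^ n) = fun n => FormalMultilinearSeries.ofScalars ℂ
        (fun n => Ring.choose (1 / (p : ℂ) + n - 1) n) n fun _ => z) ▸ h
    have hn : (n.factorial : ℂ) ≠ 0 := by exact_mod_cast n.factorial_ne_zero
    -- The coefficient of the analytic binomial series is a multichoose number, equal to (1/p)_n /
    -- n!.
    have h1 : (n.factorial : ℂ) * Ring.choose (1 / (p : ℂ) + n - 1) n =
        ((risingFact (1 / p) n : ℝ) : ℂ) := by
      rw [ofReal_risingFact, Complex.ofReal_div, Complex.ofReal_one, Complex.ofReal_natCast,
        ← Ring.multichoose_eq, ← nsmul_eq_mul,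
        Ring.factorial_nsmul_multichoose_eq_ascPochhammer, ascPochhammer_smeval_eq_eval]
    rw [negBinomSeries, PowerSeries.coeff_mk, FormalMultilinearSeries.ofScalars_apply_eq, smul_eq_mul]
    push_cast
    rw [← h1]
    field_simp
  exact e ▸ hv

/-! ### Uniqueness of the Padé approximant -/

/-- A polynomial of degree less than `N` that is `O(z^N)` at the origin vanishes. -/
theorem polynomial_eq_zero_of_isBigO {S : ℂ[X]} {N : ℕ} (hdeg : S.natDegree < N)
    (h : (fun z : ℂ => S.eval z) =O[𝓝 0] fun z : ℂ => z ^ N) : S = 0 := by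
  by_contra hS
  obtain ⟨T, hT, hTX⟩ := exists_eq_pow_rootMultiplicity_mul_and_not_dvd S hS 0
  set j := rootMultiplicity 0 S
  have hj : j < N := lt_of_le_of_lt (by
    rw [hT]
    have hT0 : T ≠ 0 := by rintro rfl; simp at hTX
    rw [natDegree_mul (pow_ne_zero _ (X_sub_C_ne_zero 0)) hT0]
    simp) hdeg
  rw [dvd_iff_isRoot] at hTX
  obtain ⟨c, hc⟩ := h.bound
  -- Cancelling z^j leaves T = O(z^(N-j)) with N - j > 0, against T(0) ≠ 0.
  have h1 : ∀ᶠ z in 𝓝[≠] (0 : ℂ), ‖T.eval z‖ ≤ c * ‖z‖ ^ (N - j) := by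
    filter_upwards [nhdsWithin_le_nhds hc, self_mem_nhdsWithin] with z hz hz0
    have hz0' : 0 < ‖z‖ ^ j := pow_pos (norm_pos_iff.2 hz0) _
    rw [hT] at hz
    simp only [map_zero, sub_zero, eval_mul, eval_pow, eval_X, norm_mul, norm_pow] at hz
    rw [show N = j + (N - j) by omega, pow_add] at hz
    refine le_of_mul_le_mul_left ?_ hz0'
    linarith
  have h2 : Tendsto (fun z : ℂ => ‖T.eval z‖) (𝓝[≠] 0) (𝓝 ‖T.eval 0‖) :=
    (T.continuous.norm.tendsto 0).mono_left nhdsWithin_le_nhds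
  have h3 : Tendsto (fun z : ℂ => c * ‖z‖ ^ (N - j)) (𝓝[≠] 0) (𝓝 0) := by
    have : Continuous fun z : ℂ => c * ‖z‖ ^ (N - j) := by fun_prop
    have := (this.tendsto 0).mono_left (nhdsWithin_le_nhds (s := {0}ᶜ))
    simpa [Nat.sub_ne_zero_of_lt hj] using this
  have := le_of_tendsto_of_tendsto h2 h3 h1
  exact hTX (norm_le_zero_iff.1 this)

/-- Uniqueness of the Padé approximant in lowest terms. -/
theorem IsPadeApproximant.unique {f : ℂ → ℂ} {k m : ℕ} {P Q P' Q' : ℂ[X]}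
    (h : IsPadeApproximant f k m P Q) (h' : IsPadeApproximant f k m P' Q') : P = P' ∧ Q = Q' := by
  have hne : ∀ {A : ℂ[X]}, A.eval 0 = 1 → ∀ᶠ z in 𝓝 (0 : ℂ), A.eval z ≠ 0 := fun {A} hA =>
    A.continuous.continuousAt.eventually_ne (by simp [hA])
  have hcross : P * Q' = P' * Q := by
    rw [← sub_eq_zero]
    refine polynomial_eq_zero_of_isBigO (N := k + m + 1) (Nat.lt_succ_of_le ?_) ?_
    · exact (natDegree_sub_le_of_le
        (natDegree_mul_le_of_le h.natDegree_num_le h'.natDegree_den_le)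
        (natDegree_mul_le_of_le h'.natDegree_num_le h.natDegree_den_le)).trans (by simp)
    · have h1 := h'.isBigO.sub h.isBigO
      have h2 : (fun z : ℂ => (Q * Q').eval z) =O[𝓝 0] fun _ : ℂ => (1 : ℂ) :=
        ((Q * Q').continuous.tendsto 0).isBigO_one ℂ
      refine (h2.mul h1).congr' ?_ (by simp)
      filter_upwards [hne h.den_zero, hne h'.den_zero] with z hz hz'
      simp only [eval_mul, eval_sub]
      field_simp
      ring
  -- Coprimality gives divisibility both ways; the normalization at 0 fixes the remaining unit.
  have hQ : Q ∣ Q' := h.coprime.symm.dvd_of_dvd_mul_left ⟨P', by rw [hcross, mul_comm]⟩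
  have hQ' : Q' ∣ Q := h'.coprime.symm.dvd_of_dvd_mul_left ⟨P, by rw [← hcross, mul_comm]⟩
  obtain ⟨u, hu⟩ := associated_of_dvd_dvd hQ hQ'
  obtain ⟨c, -, hc⟩ := Polynomial.isUnit_iff.1 u.isUnit
  have hQQ : Q = Q' := by
    have h1 := congrArg (eval 0) hu
    rw [← hc, eval_mul, eval_C, h.den_zero, h'.den_zero, one_mul] at h1
    rw [← hu, ← hc, h1, map_one, mul_one]
  subst hQQ
  have hQ0 : Q ≠ 0 := by rintro rfl; simpa using h.den_zero
  exact ⟨mul_right_cancel₀ hQ0 hcross, rfl⟩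

/-! ### Iteration of the contraction estimate -/

/-- Iterating a one-step contraction estimate of order `n + 1`. -/
theorem iterated_contraction_bound {r : ℕ → ℝ} {n : ℕ} {α : ℝ} (hn : 1 ≤ n) (hα0 : 0 ≤ α)
    (hα1 : α ≤ 1) (hr : ∀ l, 0 ≤ r l) (hr0 : r 0 < 1)
    (hstep : ∀ l, r l < 1 → r (l + 1) ≤ r l ^ (n + 1) * ((r l + α) / (1 + α * r l))) (l : ℕ) :
    r l < 1 ∧ r l ≤ r 0 ^ ((n + 1) ^ l) *
      ((r 0 + α) / (1 + α * r 0)) ^ (((n + 1) ^ l - 1) / n) := by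
  have h00 := hr 0
  set φ := (r 0 + α) / (1 + α * r 0) with hφ
  have hφ0 : 0 ≤ φ := by positivity
  have hφ1 : φ ≤ 1 := by
    rw [hφ, div_le_one (by positivity)]
    nlinarith
  have hle0 : ∀ l e : ℕ, r 0 ^ ((n + 1) ^ l) * φ ^ e ≤ r 0 := fun l e => by
    have h1 : r 0 ^ ((n + 1) ^ l) ≤ r 0 ^ 1 :=
      pow_le_pow_of_le_one h00 hr0.le (Nat.one_le_pow _ _ (by omega))
    rw [pow_one] at h1
    exact (mul_le_of_le_one_right (by positivity) (pow_le_one₀ hφ0 hφ1)).trans h1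
  -- Carrying e shows that the natural-number division in the exponent is exact.
  suffices ∃ e, (n + 1) ^ l = n * e + 1 ∧ r l ≤ r 0 ^ ((n + 1) ^ l) * φ ^ e by
    obtain ⟨e, he, hb⟩ := this
    refine ⟨?_, ?_⟩
    · exact (hb.trans (hle0 l e)).trans_lt hr0
    · rwa [show ((n + 1) ^ l - 1) / n = e by
        rw [he, Nat.add_sub_cancel, Nat.mul_div_cancel_left _ (by omega)]]
  induction l with
  | zero => exact ⟨0, by simp, by simp⟩
  | succ l ih =>
    obtain ⟨e, he, hb⟩ := ih
    have hle : r l ≤ r 0 := hb.trans (hle0 l e)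
    refine ⟨(n + 1) * e + 1, by rw [pow_succ, he]; ring, ?_⟩
    have hl := hr l
    have hmono : (r l + α) / (1 + α * r l) ≤ φ := by
      rw [hφ, div_le_div_iff₀ (by positivity) (by positivity)]
      nlinarith [mul_nonneg (sub_nonneg.2 hle) (by nlinarith : 0 ≤ 1 - α ^ 2)]
    calc r (l + 1) ≤ r l ^ (n + 1) * ((r l + α) / (1 + α * r l)) := hstep l (by linarith)
      _ ≤ (r 0 ^ ((n + 1) ^ l) * φ ^ e) ^ (n + 1) * φ := by gcongr
      _ = r 0 ^ ((n + 1) ^ (l + 1)) * φ ^ ((n + 1) * e + 1) := by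
        rw [mul_pow, ← pow_mul, ← pow_mul, pow_succ (n + 1) l, pow_succ φ, mul_comm e]
        ring

/-- After clearing the denominator the difference is α(1-α) r(1-r). -/
theorem affine_le_blaschke {r α : ℝ} (hr0 : 0 ≤ r) (hr1 : r ≤ 1) (hα0 : 0 ≤ α) (hα1 : α ≤ 1) :
    r + α * (1 - r) ≤ (r + α) / (1 + α * r) := by
  rw [le_div_iff₀ (by positivity)]
  nlinarith [mul_nonneg (mul_nonneg hα0 (sub_nonneg.2 hα1)) (mul_nonneg hr0 (sub_nonneg.2 hr1))]

/-! ### The main theorem -/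

theorem theorem2p5 (p k m : ℕ) (hp : 2 ≤ p) (hkm : m ≤ k + 1) (hpos : 1 ≤ k + m) :
    padeAlpha p k m < 1 ∧
    (∃ P Q : ℂ[X], IsPadeApproximant (invRoot p) k m P Q) ∧
    ∀ P Q : ℂ[X], IsPadeApproximant (invRoot p) k m P Q →
      (∃ c : ℕ → ℂ,
        HasFPowerSeriesAt (padeResidual p P Q) (FormalMultilinearSeries.ofScalars ℂ c) 0 ∧
        (∀ i < k + m + 1, c i = 0) ∧
        c (k + m + 1) = (padeAlpha p k m : ℂ) ∧ c (k + m + 1) ≠ 0) ∧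
      ∀ x : ℕ → ℂ, x 0 ∈ padeRegion p → (∀ l, x (l + 1) = padeStep p P Q (x l)) →
        ∀ l : ℕ,
          Q.eval (1 - x l ^ p) ≠ 0 ∧
          ‖1 - x l ^ p‖ ≤
            ‖1 - x 0 ^ p‖ ^ ((k + m + 1) ^ l) *
              ((‖1 - x 0 ^ p‖ + padeAlpha p k m) / (1 + padeAlpha p k m * ‖1 - x 0 ^ p‖)) ^
                (((k + m + 1) ^ l - 1) / (k + m)) := by
  obtain ⟨P₀, Q₀, R, hP, hQ, hQ0, ⟨c, hc0, hW⟩, hRQ, hR, hR1, hRF, hf, hfsum, hf0, hfα, hfpos⟩ :=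
    exists_pade_residual hp hkm hpos
  have hp' : (2 : ℝ) ≤ p := by exact_mod_cast hp
  have hs0 : (0 : ℝ) < 1 / p := by positivity
  have hs1 : (1 : ℝ) / p ≤ 1 := by rw [div_le_one (by linarith)]; linarith
  have hα0 := padeAlpha_pos hp k m
  have hα1 : padeAlpha p k m < 1 := by
    have := hfsum (k + m + 1 + 1 + 1)
    rw [Finset.sum_range_succ, Finset.sum_range_succ, hfα] at this
    have h1 := Finset.sum_nonneg fun i (_ : i ∈ Finset.range (k + m + 1)) => hf i
    linarith
  set P₁ := P₀.map Complex.ofRealHom with hP₁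
  set Q₁ := Q₀.map Complex.ofRealHom with hQ₁
  have hQ₁0 : Q₁.eval 0 = 1 := by
    rw [← coeff_zero_eq_eval_zero, hQ₁, coeff_map, hQ0, map_one]
  -- A common zero would be a zero of the Wronskian monomial, hence 0, but Q(0) = 1.
  have hcop : IsCoprime P₁ Q₁ := by
    refine (Polynomial.isCoprime_iff_aeval_ne_zero_of_isAlgClosed (k := ℂ) ℂ P₁ Q₁).2 fun a => ?_
    by_contra! h
    simp only [coe_aeval_eq_eval] at h
    have h1 := congrArg (fun S : ℝ[X] => (S.map Complex.ofRealHom).eval a) hW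
    simp only [Polynomial.map_sub, Polynomial.map_mul, eval_sub, eval_mul, ← hP₁, ← hQ₁, h.1, h.2,
      mul_zero, zero_mul, sub_zero, map_C, eval_C, Polynomial.map_pow, map_X, eval_pow, eval_X] at h1
    rcases mul_eq_zero.1 h1.symm with h2 | h2
    · exact hc0 (by simpa using h2)
    · rw [eq_zero_of_pow_eq_zero h2, hQ₁0] at h
      exact one_ne_zero h.2
  have heval : ∀ z : ℂ, ‖z‖ < 1 → Q₁.eval z ≠ 0 ∧ EvalsTo R z (P₁.eval z / Q₁.eval z) := by
    intro z hz
    obtain ⟨v, hv, -⟩ := EvalsTo.exists_of_abs_coeff_le_one (A := R)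
      (fun n => by rw [abs_of_nonneg (hR n)]; exact hR1 n) hz
    have h1 := hv.mul (EvalsTo.polynomial Q₀ z)
    rw [hRQ] at h1
    have h2 := h1.unique (EvalsTo.polynomial P₀ z)
    rw [← hP₁, ← hQ₁] at h2
    -- R converges at z and R Q = P, so a zero of Q would also be one of P.
    have hne : Q₁.eval z ≠ 0 := by
      intro h0
      rw [h0, mul_zero] at h2
      obtain ⟨a, b, hab⟩ := hcop
      have := congrArg (eval z) hab
      simp [h0, ← h2] at this
    exact ⟨hne, by rwa [← h2, mul_div_cancel_right₀ _ hne]⟩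
  have hpade : IsPadeApproximant (invRoot p) k m P₁ Q₁ := by
    refine ⟨natDegree_map_le.trans hP, natDegree_map_le.trans hQ, hQ₁0, hcop, ?_⟩
    refine Asymptotics.IsBigO.of_bound 2 ?_
    filter_upwards [Metric.ball_mem_nhds (0 : ℂ) (by norm_num : (0 : ℝ) < 1 / 2)] with z hz
    rw [mem_ball_zero_iff] at hz
    have hz1 : ‖z‖ < 1 := by linarith
    have h1 := ((invRoot_evalsTo hp hz1).sub (heval z hz1).2).norm_le_of_coeff_eq_zero
      (N := k + m + 1)
      (fun n => by
        rw [map_sub, abs_le]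
        have := negBinomSeries_nonneg hs0 n
        have := negBinomSeries_coeff_le_one hs0 hs1 n
        constructor <;> linarith [hR n, hR1 n])
      (fun n hn => by rw [map_sub, hRF n hn, sub_self]) hz1
    refine h1.trans ?_
    rw [norm_pow]
    gcongr
    rw [inv_le_comm₀ (by linarith) (by norm_num)]
    linarith
  refine ⟨hα1, ⟨P₁, Q₁, hpade⟩, fun P Q hPQ => ?_⟩
  obtain ⟨hPP, hQQ⟩ := hPQ.unique hpade
  rw [hPP, hQQ]
  have hres : ∀ z : ℂ, ‖z‖ < 1 → EvalsTo (formalResidual p R) z (padeResidual p P₁ Q₁ z) :=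
    fun z hz => (heval z hz).2.formalResidual p
  refine ⟨⟨fun n => ((PowerSeries.coeff n (formalResidual p R) : ℝ) : ℂ), ?_, ?_, ?_, ?_⟩, ?_⟩
  · rw [hasFPowerSeriesAt_iff]
    filter_upwards [Metric.ball_mem_nhds (0 : ℂ) one_pos] with z hz
    rw [mem_ball_zero_iff] at hz
    simpa [mul_comm] using (hres z hz).hasSum
  · intro i hi
    simp [hf0 i hi]
  · simp [hfα]
  · simpa [hfα] using hα0.ne'
  · intro x hx0 hx l
    have hstep : ∀ l, ‖1 - x l ^ p‖ < 1 → ‖1 - x (l + 1) ^ p‖ ≤ ‖1 - x l ^ p‖ ^ (k + m + 1) *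
        ((‖1 - x l ^ p‖ + padeAlpha p k m) / (1 + padeAlpha p k m * ‖1 - x l ^ p‖)) := by
      intro l hl
      have h1 : 1 - x (l + 1) ^ p = padeResidual p P₁ Q₁ (1 - x l ^ p) := by
        rw [hx, padeStep, padeResidual, mul_pow, sub_sub_cancel]
      rw [h1]
      refine ((hres _ hl).norm_le_of_nonneg hf hfsum hf0 hfα hl.le).trans ?_
      gcongr
      exact affine_le_blaschke (norm_nonneg _) hl.le hα0.le hα1.le
    have := iterated_contraction_bound (r := fun l => ‖1 - x l ^ p‖) hpos hα0.le hα1.le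
      (fun l => norm_nonneg _) hx0 hstep l
    exact ⟨(heval _ this.1).1, this.2⟩
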